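/- **Theorem.** For every 2D turedo $T$ of radius $1$ there is a 2D turedo $T'$ of radius $1$ that $T$ does not rigorously simulate. In particular, no 2D turedo of radius $1$ is rigorously universal for $\mathrm{TUR}_2(1)$, i.e. $\mathcal U_2^{\le_R}(1)\cap \mathrm{TUR}_2(1)=\emptyset$. **Definitions.** *Turedos.* Let $B_d(r)=\{z\in\mathbb Z^d:\sum_i|z_i|\le r\}$, and write $c[z;S]$ for the map $S\ni s\mapsto c(z+s)$. A turedo of dimension $d$ and radius $r$ is a triple $T=(A,Q,\delta)$, where $A$ is a finite alphabet containing the blank symbol $\bot$, $Q$ is a finite set of head states, and $\delta:Q\times A^{B_d(r)}\to Q\times (A\setminus\{\bot\})\times B_d(1)$. Let $\mathrm{TUR}_d(r)$ be the set of these, and $\mathrm{TUR}_d=\bigcup_{r\ge1}\mathrm{TUR}_d(r)$. A global state is a triple $(c,z,q)\in A^{\mathbb Z^d}\times\mathbb Z^d\times Q$. With $(q',a,\mu)=\delta(q,c[z;B_d(r)])$, the global map $F_T$ sends $(c,z,q)$ to itself if $c(z)\ne\bot$ or $c(z+\mu)\neq\bot$, and otherwise to $(c',z+\mu,q')$, where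 $c'(z)=a$ and $c'=c$ elsewhere. The domain of $(c,z,q)$ is $\mathcal D(c,z,q)=\{z\}\cup\{z':c(z')\ne\bot\}$; the global state is finite if its domain is finite. *Block encodings.* For $b\in\mathbb N_+^d$ let $R_b=\prod_i\{0,\dots,b_i-1\}$, let $\otimes$ be the component-wise product, and write each $z\in\mathbb Z^d$ uniquely as $z=\rho_b(z)+\mu_b(z)$ with $\rho_b(z)\in b\otimes\mathbb Z^d$ and $\mu_b(z)\in R_b$. A block encoding of the global states of $T_1$ into those of $T_2$ consists of a block size $b\in\mathbb N_+^d$ and two partial maps, both onto, $\alpha:A_2^{R_b}\rightharpoonup A_1$ and $\beta:A_2^{R_b}\times R_b\times Q_2\rightharpoonup Q_1\times A_1$, such that $\alpha(\bot^{R_b})$ is defined and equal to $\bot$. A global state $(c_2,z_2,q_2)$ of $T_2$ is valid if $\beta(c_2[\rho_b(z_2);R_b],\mu_b(z_2),q_2)$ is defined and $\alpha(c_2[\rho_b(z');R_b])$ is defined whenever $\rho_b(z')\ne\rho_b(z_2)$. It is then decoded to $\Gamma(c_2,z_2,q_2)=(c_1,z_1,q_1)$, where $b\otimes z_1=\rho_b(z_2)$,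 $(q_1,c_1(z_1))=\beta(c_2[\rho_b(z_2);R_b],\mu_b(z_2),q_2)$ and $c_1(z)=\alpha(c_2[b\otimes z;R_b])$ for $z\ne z_1$. The block domain of $(c_2,z_2,q_2)$ is $\{z: b\otimes z=\rho_b(z_2)\text{ or }c_2[b\otimes z;R_b]\ne\bot^{R_b}\}$. *Rigorous simulation.* $T_2$ rigorously simulates $T_1$ (written $T_1\le_R T_2$) if there are a block encoding of the global states of $T_1$ into those of $T_2$ and an integer $k\ge1$ such that, for every finite global state $g_1$ of $T_1$ and every valid global state $g_2$ of $T_2$ with $\Gamma(g_2)=g_1$ whose block domain is $\mathcal D(g_1)$, the following two conditions hold. 1. For all $t\in\mathbb N$, $F_{T_2}^{kt}(g_2)$ is valid and $\Gamma(F_{T_2}^{kt}(g_2))=F_{T_1}^t(g_1)$. 2. For all $t,t'\in\mathbb N$ with $kt\le t'\le k(t+1)$, the head position of $F_{T_2}^{t'}(g_2)$ lies in $(b\otimes z_1^t+R_b)\cup(b\otimes z_1^{t+1}+R_b)$, where $z_1^t$ is the head position of $F_{T_1}^t(g_1)$. *Universality.* $\mathcal U_d^{\le_R}(r)$ is the set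 of $T\in\mathrm{TUR}_d$ such that $T'\le_R T$ for all $T'\in\mathrm{TUR}_d(r)$; such a $T$ is called rigorously universal for $\mathrm{TUR}_d(r)$. -/

import Mathlib

namespace TuredoModel

/-- Positions of the `d`-dimensional grid. -/
abbrev Pos (d : ℕ) : Type := Fin d → ℤ

/-- The ball of radius `r`: the positions reachable from the origin by at most `r` moves
along `±` vectors of the canonical basis, that is the `ℓ¹` ball. -/
def ball (d r : ℕ) : Set (Pos d) := {z | ∑ i, |z i| ≤ (r : ℤ)}

/-- The pattern `c[z; S]` of shape `S` around position `z` in `c`. -/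
def pattern {d : ℕ} {A : Type} (c : Pos d → A) (z : Pos d) (S : Set (Pos d)) : S → A :=
  fun s => c (z + s)

/-- Global states: a configuration, a head position and a head state. -/
@[ext]
structure GlobalState (d : ℕ) (A Q : Type) where
  conf : Pos d → A
  pos : Pos d
  state : Q

/-- A `d`-dimensional turedo of some radius. -/
structure Turedo (d : ℕ) where
  radius : ℕ
  /-- the alphabet -/
  A : Type
  /-- the head states -/
  Q : Type
  /-- the blank symbol -/
  blank : A
  finite_A : Finite A
  finite_Q : Finite Q
  /-- the local transition map -/
  δ : Q × (ball d radius → A) → Q × {a : A // a ≠ blank} × ball d 1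

namespace Turedo

variable {d : ℕ} (T : Turedo d)

/-- Global states of the turedo `T`. -/
abbrev State : Type := GlobalState d T.A T.Q

/-- The result of the local transition map at the head. -/
def localStep (g : T.State) : T.Q × {a : T.A // a ≠ T.blank} × ball d 1 :=
  T.δ (g.state, pattern g.conf g.pos (ball d T.radius))

open Classical in
/-- The global transition map. -/
noncomputable def step (g : T.State) : T.State :=
  if g.conf g.pos ≠ T.blank ∨ g.conf (g.pos + (T.localStep g).2.2) ≠ T.blank then g
  else
    { conf := Function.update g.conf g.pos (T.localStep g).2.1
      pos := g.pos + (T.localStep g).2.2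
      state := (T.localStep g).1 }

/-- The `t`-th iterate of the global transition map. -/
noncomputable def orbit (t : ℕ) (g : T.State) : T.State := T.step^[t] g

/-- The domain of a global state: its non-blank positions and the head position. -/
def domain (g : T.State) : Set (Pos d) := {g.pos} ∪ {z | g.conf z ≠ T.blank}

end Turedo

/-- `TUR d r`: the turedos of dimension `d` and radius `r`. -/
def TUR (d r : ℕ) : Set (Turedo d) := {T | T.radius = r}

/-- `TURdim d`: the turedos of dimension `d` and of any positive radius. -/
def TURdim (d : ℕ) : Set (Turedo d) := ⋃ r ≥ 1, TUR d r

/-! Blocks. -/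

/-- The rectangular block with side lengths `b`. -/
def rect {d : ℕ} (b : Fin d → ℕ+) : Set (Pos d) := {z | ∀ i, 0 ≤ z i ∧ z i < (b i : ℕ)}

/-- The component-wise product of `b` and `z`. -/
def scale {d : ℕ} (b : Fin d → ℕ+) (z : Pos d) : Pos d := fun i => (b i : ℕ) * z i

/-- The index of the block that contains `z`. -/
def blockIndex {d : ℕ} (b : Fin d → ℕ+) (z : Pos d) : Pos d := fun i => z i / (b i : ℕ)

/-- The reference point of the block that contains `z`. -/
def refPoint {d : ℕ} (b : Fin d → ℕ+) (z : Pos d) : Pos d := scale b (blockIndex b z)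

/-- The offset of `z` inside its block. -/
def offset {d : ℕ} (b : Fin d → ℕ+) (z : Pos d) : rect b :=
  ⟨fun i => z i % (b i : ℕ), fun i =>
    ⟨Int.emod_nonneg _ (by exact_mod_cast (b i).ne_zero),
      Int.emod_lt_of_pos _ (by exact_mod_cast (b i).pos)⟩⟩

/-- Each position is its block's reference point plus its offset. -/
theorem refPoint_add_offset {d : ℕ} (b : Fin d → ℕ+) (z : Pos d) :
    refPoint b z + offset b z = z := by
  funext i
  exact Int.mul_ediv_add_emod (z i) ((b i : ℕ) : ℤ)

theorem scale_injective {d : ℕ} (b : Fin d → ℕ+) : Function.Injective (scale b) := by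
  intro x y h
  funext i
  have hb : (((b i : ℕ)) : ℤ) ≠ 0 := by exact_mod_cast (b i).ne_zero
  exact mul_left_cancel₀ hb (congrFun h i)

theorem blockIndex_scale {d : ℕ} (b : Fin d → ℕ+) (z : Pos d) :
    blockIndex b (scale b z) = z := by
  funext i
  have hb : (((b i : ℕ)) : ℤ) ≠ 0 := by exact_mod_cast (b i).ne_zero
  exact Int.mul_ediv_cancel_left (z i) hb

/-- A block encoding of the global states of `T₁` into those of `T₂`. The partial maps
`α` and `β` are given as `Option`-valued maps, `none` meaning undefined. -/
structure BlockEncoding {d : ℕ} (T₁ T₂ : Turedo d) where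
  /-- the block size -/
  b : Fin d → ℕ+
  /-- the headless block decoding map -/
  α : (rect b → T₂.A) → Option T₁.A
  /-- the head block decoding map -/
  β : (rect b → T₂.A) × rect b × T₂.Q → Option (T₁.Q × T₁.A)
  α_onto : ∀ a, ∃ u, α u = some a
  β_onto : ∀ p, ∃ v, β v = some p
  α_blank : α (fun _ => T₂.blank) = some T₁.blank

namespace BlockEncoding

variable {d : ℕ} {T₁ T₂ : Turedo d} (E : BlockEncoding T₁ T₂)

/-- The block of the head, the offset of the head in it, and the head state. -/
def headBlock (g : T₂.State) : (rect E.b → T₂.A) × rect E.b × T₂.Q :=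
  (pattern g.conf (refPoint E.b g.pos) (rect E.b), offset E.b g.pos, g.state)

/-- A global state of `T₂` is valid if its head block lies in the domain of `β` and all
its other blocks lie in the domain of `α`. -/
def Valid (g : T₂.State) : Prop :=
  (E.β (E.headBlock g)).isSome ∧
    ∀ z' : Pos d, refPoint E.b z' ≠ refPoint E.b g.pos →
      (E.α (pattern g.conf (refPoint E.b z') (rect E.b))).isSome

theorem Valid.isSome_α {E : BlockEncoding T₁ T₂} {g : T₂.State} (h : E.Valid g) {z : Pos d}
    (hz : z ≠ blockIndex E.b g.pos) :
    (E.α (pattern g.conf (scale E.b z) (rect E.b))).isSome := by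
  have h2 := h.2 (scale E.b z)
  simp only [refPoint, blockIndex_scale] at h2
  exact h2 fun e => hz (scale_injective E.b e)

open Classical in
/-- The global decoding map, defined on valid global states. -/
noncomputable def decode (g : T₂.State) (h : E.Valid g) : T₁.State where
  pos := blockIndex E.b g.pos
  state := ((E.β (E.headBlock g)).get h.1).1
  conf := fun z =>
    if hz : z = blockIndex E.b g.pos then ((E.β (E.headBlock g)).get h.1).2
    else (E.α (pattern g.conf (scale E.b z) (rect E.b))).get (h.isSome_α hz)

/-- `g₂` is valid and the global decoding map sends it to `g₁`. -/
def Decodes (g₂ : T₂.State) (g₁ : T₁.State) : Prop := ∃ h : E.Valid g₂, E.decode g₂ h = g₁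

/-- The block domain of a global state: the blocks that contain the head or are not
entirely blank. -/
def blockDomain (g : T₂.State) : Set (Pos d) :=
  {z | scale E.b z = refPoint E.b g.pos ∨
    pattern g.conf (scale E.b z) (rect E.b) ≠ fun _ => T₂.blank}

/-- `g₁` is a finite global state of `T₁`, and `g₂` is a correct encoding of it with
corresponding block domain. -/
def Represents (g₂ : T₂.State) (g₁ : T₁.State) : Prop :=
  (T₁.domain g₁).Finite ∧ T₁.domain g₁ = E.blockDomain g₂ ∧ E.Decodes g₂ g₁

/-- With block encoding `E` and time scaling factor `k`, the turedo `T₂` simulates `T₁`. -/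
def IsSimulation (k : ℕ) : Prop :=
  ∀ (g₁ : T₁.State) (g₂ : T₂.State), E.Represents g₂ g₁ →
    ∀ t : ℕ, E.Decodes (T₂.orbit (k * t) g₂) (T₁.orbit t g₁)

/-- The block at index `z`, as a set of positions. -/
def cell (z : Pos d) : Set (Pos d) := {x | ∃ y ∈ rect E.b, x = scale E.b z + y}

/-- In simulating orbits the head of `T₂` stays, also at intermediate steps, in the blocks
of the current and the next head position of `T₁`. -/
def IsRigorous (k : ℕ) : Prop :=
  ∀ (g₁ : T₁.State) (g₂ : T₂.State), E.Represents g₂ g₁ →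
    ∀ t t' : ℕ, k * t ≤ t' → t' ≤ k * (t + 1) →
      (T₂.orbit t' g₂).pos ∈ E.cell (T₁.orbit t g₁).pos ∪ E.cell (T₁.orbit (t + 1) g₁).pos

end BlockEncoding

/-- `RigSim T₁ T₂`: the turedo `T₂` rigorously simulates `T₁`. -/
def RigSim {d : ℕ} (T₁ T₂ : Turedo d) : Prop :=
  ∃ (E : BlockEncoding T₁ T₂) (k : ℕ), 0 < k ∧ E.IsSimulation k ∧ E.IsRigorous k

/-- The turedos of dimension `d` that are rigorously universal for `TUR d r`. -/
def rigUniv (d r : ℕ) : Set (Turedo d) :=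
  {T | T ∈ TURdim d ∧ ∀ T' ∈ TUR d r, RigSim T' T}

end TuredoModel

namespace TuredoModel

/-! Let `T` have radius 1 and alphabet `A`. The turedo `probe A` has one more nonblank letter than
`A` has symbols. What defeats `T` is how little of a block can be seen across its border, in two
tasks.

Copying: the head walks right through (-1,0), (0,0), (1,0), copies the letter at (2,0) into (1,0)
and leaves upwards. By rigour, `T` sees the block (2,0) only from the right column of the block
(1,0), and at the first contact it sees a single cell of it. By pigeonhole two letters show the same
symbol there. The path walked so far separates the bottom of the block (1,0) from the way out at the
top. A head that meets its former path is stuck (`orbit_pos_eq_of_revisit`), so by planarity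
(`exists_eq_of_crossing`) it never returns to the bottom row. That row is therefore the same for
both letters, although the finished blocks decode to different letters
(`exists_blocks_same_bottom`).

Reading: the head at the origin copies the letter above it and goes right. By rigour, `T` sees only
the bottom row of the block above. With the two blocks just found it behaves identically, yet it has
to produce different letters (`not_rigSim_probe`). -/

theorem mem_ball_two {s : Pos 2} {r : ℕ} : s ∈ ball 2 r ↔ |s 0| + |s 1| ≤ (r : ℤ) := by
  simp [ball, Fin.sum_univ_two]

/-! Crossing paths in the grid. -/

theorem eq_of_abs_add_abs_le_one {a b a' b' : ℤ} (h : |a' - a| + |b' - b| ≤ 1) :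
    (a' = a ∧ b' = b) ∨ (a' = a + 1 ∧ b' = b) ∨ (a = a' + 1 ∧ b = b') ∨
      (a' = a ∧ b' = b + 1) ∨ (a = a' ∧ b = b' + 1) := by
  rcases abs_cases (a' - a) with h1 | h1 <;> rcases abs_cases (b' - b) with h2 | h2 <;> omega

/-- The signed number of times that the first `n` steps of `q` go up from row `z 1` to the next
row, at the left of column `z 0`. -/
def crossings (q : ℕ → Pos 2) (n : ℕ) (z : Pos 2) : ℤ :=
  ∑ j ∈ Finset.range n, (if q j 0 < z 0 then 1 else 0) *
    ((if z 1 < q (j + 1) 1 then 1 else 0) - (if z 1 < q j 1 then 1 else 0))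

/-- The two sums can differ only by vertical steps in the column of `z` between its row and the
next, and such a step has `z` as an endpoint. -/
theorem crossings_add_right {q : ℕ → Pos 2} {n : ℕ} {z z' : Pos 2}
    (hq : ∀ j < n, |q (j + 1) 0 - q j 0| + |q (j + 1) 1 - q j 1| ≤ 1)
    (hz : ∀ j ≤ n, q j ≠ z) (h0 : z' 0 = z 0 + 1) (h1 : z' 1 = z 1) :
    crossings q n z = crossings q n z' := by
  refine Finset.sum_congr rfl fun j hj => ?_
  have hj := Finset.mem_range.1 hj
  have e1 : ¬ (q j 0 = z 0 ∧ q j 1 = z 1) := fun h =>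
    hz j hj.le (funext fun i => by fin_cases i <;> simp [h.1, h.2])
  have e2 : ¬ (q (j + 1) 0 = z 0 ∧ q (j + 1) 1 = z 1) := fun h =>
    hz (j + 1) hj (funext fun i => by fin_cases i <;> simp [h.1, h.2])
  have e3 := eq_of_abs_add_abs_le_one (hq j hj)
  rw [h0, h1]
  split_ifs <;> simp <;> omega

/-- The difference counts vertical entries minus vertical exits of the half-row strictly left of
`z'`. As `q` avoids `z'`, there are no horizontal ones, so the sum telescopes. Both end terms vanish
because `q` starts below this row and ends above it. -/
theorem crossings_add_up {q : ℕ → Pos 2} {n : ℕ} {z z' : Pos 2}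
    (hq : ∀ j < n, |q (j + 1) 0 - q j 0| + |q (j + 1) 1 - q j 1| ≤ 1)
    (hz : ∀ j ≤ n, q j ≠ z') (h0 : z' 0 = z 0) (h1 : z' 1 = z 1 + 1)
    (hs : q 0 1 ≤ z 1) (he : z' 1 < q n 1) :
    crossings q n z = crossings q n z' := by
  have key : crossings q n z - crossings q n z' = ∑ j ∈ Finset.range n,
      ((if q (j + 1) 0 < z 0 ∧ q (j + 1) 1 = z 1 + 1 then (1 : ℤ) else 0) -
        (if q j 0 < z 0 ∧ q j 1 = z 1 + 1 then 1 else 0)) := by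
    rw [crossings, crossings, ← Finset.sum_sub_distrib]
    refine Finset.sum_congr rfl fun j hj => ?_
    have hj := Finset.mem_range.1 hj
    have e1 : ¬ (q j 0 = z' 0 ∧ q j 1 = z' 1) := fun h =>
      hz j hj.le (funext fun i => by fin_cases i <;> simp [h.1, h.2])
    have e2 : ¬ (q (j + 1) 0 = z' 0 ∧ q (j + 1) 1 = z' 1) := fun h =>
      hz (j + 1) hj (funext fun i => by fin_cases i <;> simp [h.1, h.2])
    have e3 := eq_of_abs_add_abs_le_one (hq j hj)
    rw [h0, h1] at *
    split_ifs <;> simp <;> omega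
  rw [Finset.sum_range_sub (fun j => if q j 0 < z 0 ∧ q j 1 = z 1 + 1 then (1 : ℤ) else 0),
    if_neg (by omega), if_neg (by omega)] at key
  omega

/-- A grid path from left to right meets a grid path from bottom to top. -/
theorem exists_eq_of_crossing {p q : ℕ → Pos 2} {m n : ℕ} {H : ℤ}
    (hp : ∀ i < m, |p (i + 1) 0 - p i 0| + |p (i + 1) 1 - p i 1| ≤ 1)
    (hq : ∀ j < n, |q (j + 1) 0 - q j 0| + |q (j + 1) 1 - q j 1| ≤ 1)
    (hpH : ∀ i ≤ m, 0 ≤ p i 1 ∧ p i 1 < H)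
    (hl : ∀ j ≤ n, p 0 0 ≤ q j 0) (hr : ∀ j ≤ n, q j 0 ≤ p m 0)
    (hs : q 0 1 ≤ 0) (he : H ≤ q n 1) : ∃ i ≤ m, ∃ j ≤ n, p i = q j := by
  -- For disjoint paths the crossing number of `q` is constant along `p`. It is 0 at the start of
  -- `p`, as `q` is never further left, and 1 at its end, as `q` is never further right and has to
  -- rise past that row.
  by_contra! hne
  have hconst : ∀ i ≤ m, crossings q n (p i) = 0 := by
    intro i
    induction i with
    | zero =>
      intro _
      refine Finset.sum_eq_zero fun j hj => ?_
      rw [if_neg (not_lt.2 (hl j (Finset.mem_range.1 hj).le)), zero_mul]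
    | succ i ih =>
      intro hi
      have hne0 : ∀ j ≤ n, q j ≠ p i := fun j hj h => hne i (by omega) j hj h.symm
      have hne1 : ∀ j ≤ n, q j ≠ p (i + 1) := fun j hj h => hne (i + 1) hi j hj h.symm
      have b0 := hpH i (by omega)
      have b1 := hpH (i + 1) hi
      rw [← ih (by omega)]
      rcases eq_of_abs_add_abs_le_one (hp i hi) with h | h | h | h | h
      · rw [crossings, crossings, h.1, h.2]
      · exact (crossings_add_right hq hne0 h.1 h.2).symm
      · exact crossings_add_right hq hne1 h.1 h.2
      · exact (crossings_add_up hq hne1 h.1 h.2 (by omega) (by omega)).symm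
      · exact crossings_add_up hq hne0 h.1 h.2 (by omega) (by omega)
  have bm := hpH m le_rfl
  have total : crossings q n (p m) = ∑ j ∈ Finset.range n,
      ((if p m 1 < q (j + 1) 1 then (1 : ℤ) else 0) - (if p m 1 < q j 1 then 1 else 0)) := by
    refine Finset.sum_congr rfl fun j hj => ?_
    have hj := Finset.mem_range.1 hj
    -- A crossing in the column of `p m` itself would go uncounted, but it would pass through `p m`.
    have e1 : ¬ (q j 0 = p m 0 ∧ q j 1 = p m 1) := fun h =>
      hne m le_rfl j hj.le (funext fun i => by fin_cases i <;> simp [h.1, h.2])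
    have e2 : ¬ (q (j + 1) 0 = p m 0 ∧ q (j + 1) 1 = p m 1) := fun h =>
      hne m le_rfl (j + 1) hj (funext fun i => by fin_cases i <;> simp [h.1, h.2])
    have e3 := eq_of_abs_add_abs_le_one (hq j hj)
    have e4 := hr j hj.le
    split_ifs <;> simp <;> omega
  rw [Finset.sum_range_sub (fun j => if p m 1 < q j 1 then (1 : ℤ) else 0),
    if_pos (by omega), if_neg (by omega), hconst m le_rfl] at total
  omega

/-! Orbits of turedos. -/

namespace Turedo

variable {d : ℕ} (T : Turedo d)

theorem orbit_succ (t : ℕ) (g : T.State) : T.orbit (t + 1) g = T.step (T.orbit t g) :=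
  Function.iterate_succ_apply' _ _ _

theorem step_of_blank {g : T.State} (h : g.conf g.pos = T.blank)
    (h' : g.conf (g.pos + (T.localStep g).2.2) = T.blank) :
    T.step g = ⟨Function.update g.conf g.pos (T.localStep g).2.1,
      g.pos + (T.localStep g).2.2, (T.localStep g).1⟩ := by
  rw [step, if_neg (by simp [h, h'])]

theorem step_eq_self {g : T.State} (h : g.conf g.pos ≠ T.blank) : T.step g = g :=
  if_pos (Or.inl h)

theorem step_eq_self_or (g : T.State) : T.step g = g ∨
    (T.step g = ⟨Function.update g.conf g.pos (T.localStep g).2.1,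
      g.pos + (T.localStep g).2.2, (T.localStep g).1⟩) := by
  by_cases h : g.conf g.pos = T.blank
  · by_cases h' : g.conf (g.pos + (T.localStep g).2.2) = T.blank
    · exact Or.inr (T.step_of_blank h h')
    · exact Or.inl (if_pos (Or.inr h'))
  · exact Or.inl (T.step_eq_self h)

theorem step_conf_of_ne (g : T.State) {z : Pos d} (h : z ≠ g.pos) :
    (T.step g).conf z = g.conf z := by
  rcases T.step_eq_self_or g with e | e <;> rw [e]
  exact Function.update_of_ne h _ _

theorem step_conf_ne_blank (g : T.State) {z : Pos d} (h : g.conf z ≠ T.blank) :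
    (T.step g).conf z ≠ T.blank := by
  by_cases hz : z = g.pos
  · rw [T.step_eq_self (hz ▸ h)]
    exact h
  · rwa [T.step_conf_of_ne g hz]

theorem step_pos_sub_mem (g : T.State) : (T.step g).pos - g.pos ∈ ball d 1 := by
  rcases T.step_eq_self_or g with e | e <;> rw [e]
  · simp [ball]
  · simp

theorem orbit_eq_of_step_eq {g : T.State} {i j : ℕ} (hij : i ≤ j)
    (h : T.step (T.orbit i g) = T.orbit i g) : T.orbit j g = T.orbit i g := by
  induction j, hij using Nat.le_induction with
  | base => rfl
  | succ j _ ih => rw [orbit_succ, ih, h]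

theorem orbit_conf_eq {g : T.State} {z : Pos d} {i j : ℕ} (hij : i ≤ j)
    (h : ∀ l, i ≤ l → l < j → (T.orbit l g).pos ≠ z) :
    (T.orbit j g).conf z = (T.orbit i g).conf z := by
  induction j, hij using Nat.le_induction with
  | base => rfl
  | succ j hj ih =>
    rw [orbit_succ, T.step_conf_of_ne _ (h j hj j.lt_succ_self).symm]
    exact ih fun l h1 h2 => h l h1 (h2.trans j.lt_succ_self)

/-- A head that returns to a former position stays there. -/
theorem orbit_pos_eq_of_revisit {g : T.State} {i j n : ℕ} (hij : i < j) (hjn : j ≤ n)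
    (h : (T.orbit i g).pos = (T.orbit j g).pos) : (T.orbit n g).pos = (T.orbit j g).pos := by
  -- Either the orbit is already constant from time `i`, or step `i` leaves a nonblank letter that
  -- halts the head on its return.
  rcases T.step_eq_self_or (T.orbit i g) with e | e
  · rw [T.orbit_eq_of_step_eq hij.le e, T.orbit_eq_of_step_eq (hij.le.trans hjn) e]
  · have hnb : ∀ l, i + 1 ≤ l → (T.orbit l g).conf (T.orbit i g).pos ≠ T.blank := by
      intro l hl
      induction l, hl using Nat.le_induction with
      | base =>
        rw [orbit_succ, e]
        simpa using (T.localStep (T.orbit i g)).2.1.2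
      | succ l _ ih =>
        rw [orbit_succ]
        exact T.step_conf_ne_blank _ ih
    rw [T.orbit_eq_of_step_eq hjn (T.step_eq_self (h ▸ hnb j hij))]

/-- Two global states with the same head whose configurations agree on `S`. -/
def AgreeOn (S : Set (Pos d)) (g g' : T.State) : Prop :=
  g.pos = g'.pos ∧ g.state = g'.state ∧ ∀ z ∈ S, g.conf z = g'.conf z

variable {T}

theorem AgreeOn.symm {S : Set (Pos d)} {g g' : T.State} (h : T.AgreeOn S g g') :
    T.AgreeOn S g' g :=
  ⟨h.1.symm, h.2.1.symm, fun z hz => (h.2.2 z hz).symm⟩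

theorem AgreeOn.trans {S : Set (Pos d)} {g g' g'' : T.State} (h : T.AgreeOn S g g')
    (h' : T.AgreeOn S g' g'') : T.AgreeOn S g g'' :=
  ⟨h.1.trans h'.1, h.2.1.trans h'.2.1, fun z hz => (h.2.2 z hz).trans (h'.2.2 z hz)⟩

/-- At radius 1, all that a step reads lies in the unit ball around the head, including the target
cell that is tested for being blank. -/
theorem AgreeOn.step (hr : T.radius = 1) {S : Set (Pos d)} {g g' : T.State}
    (h : T.AgreeOn S g g') (hS : ∀ s ∈ ball d 1, g.pos + s ∈ S) :
    T.AgreeOn S (T.step g) (T.step g') := by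
  obtain ⟨c, p, q⟩ := g
  obtain ⟨c', p', q'⟩ := g'
  obtain ⟨rfl, rfl, hc⟩ : p = p' ∧ q = q' ∧ ∀ z ∈ S, c z = c' z := h
  have hl : T.localStep ⟨c, p, q⟩ = T.localStep ⟨c', p, q⟩ := by
    have : pattern c p (ball d T.radius) = pattern c' p (ball d T.radius) :=
      funext fun s => hc _ (hS s (hr ▸ s.2))
    simp only [localStep, this]
  have h0 : c p = c' p := by
    have := hc _ (hS 0 (by simp [ball]))
    rwa [add_zero] at this
  have h1 := hc _ (hS _ (T.localStep ⟨c', p, q⟩).2.2.2)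
  by_cases hA : c' p ≠ T.blank ∨ c' (p + (T.localStep ⟨c', p, q⟩).2.2) ≠ T.blank
  · have e' : T.step ⟨c', p, q⟩ = ⟨c', p, q⟩ := if_pos hA
    have e : T.step ⟨c, p, q⟩ = ⟨c, p, q⟩ := if_pos (by
      simpa only [hl, h0, h1] using hA)
    rw [e, e']
    exact ⟨rfl, rfl, hc⟩
  · push Not at hA
    rw [T.step_of_blank (g := ⟨c', p, q⟩) hA.1 hA.2,
      T.step_of_blank (g := ⟨c, p, q⟩) (h0.trans hA.1) (hl ▸ h1.trans hA.2), hl]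
    refine ⟨rfl, rfl, fun z hz => ?_⟩
    by_cases hzp : z = p
    · subst hzp; simp
    · simpa [Function.update_of_ne hzp] using hc z hz

theorem AgreeOn.orbit (hr : T.radius = 1) {S : Set (Pos d)} {g g' : T.State}
    (h : T.AgreeOn S g g') {t : ℕ}
    (hS : ∀ i < t, ∀ s ∈ ball d 1, (T.orbit i g).pos + s ∈ S) :
    T.AgreeOn S (T.orbit t g) (T.orbit t g') := by
  induction t with
  | zero => exact h
  | succ t ih =>
    rw [orbit_succ, orbit_succ]
    exact (ih fun i hi => hS i (by omega)).step hr (hS t t.lt_succ_self)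

end Turedo

theorem abs_orbit_pos_sub_le {T : Turedo 2} (g : T.State) (t : ℕ) :
    |(T.orbit (t + 1) g).pos 0 - (T.orbit t g).pos 0| +
      |(T.orbit (t + 1) g).pos 1 - (T.orbit t g).pos 1| ≤ 1 := by
  rw [T.orbit_succ]
  simpa using mem_ball_two.1 (T.step_pos_sub_mem (T.orbit t g))

/-! Encoding global states. -/

section Blocks

variable {d : ℕ} (b : Fin d → ℕ+)

theorem blockIndex_scale_add (w : Pos d) (s : rect b) : blockIndex b (scale b w + s) = w := by
  funext i
  have hb : (((b i : ℕ)) : ℤ) ≠ 0 := by exact_mod_cast (b i).ne_zero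
  have h : ((b i : ℕ) * w i + (s : Pos d) i) / ((b i : ℕ) : ℤ) = w i := by
    rw [Int.mul_add_ediv_left _ _ hb, Int.ediv_eq_zero_of_lt (s.2 i).1 (s.2 i).2, add_zero]
  exact h

theorem offset_scale_add (w : Pos d) (s : rect b) : offset b (scale b w + s) = s := by
  refine Subtype.ext (funext fun i => ?_)
  have h : ((b i : ℕ) * w i + (s : Pos d) i) % ((b i : ℕ) : ℤ) = (s : Pos d) i := by
    rw [Int.mul_add_emod_self_left, Int.emod_eq_of_lt (s.2 i).1 (s.2 i).2]
  exact h

/-- The configuration with the given blocks. -/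
def ofBlocks {A : Type} (B : Pos d → rect b → A) (z : Pos d) : A := B (blockIndex b z) (offset b z)

theorem ofBlocks_scale_add {A : Type} (B : Pos d → rect b → A) (w : Pos d) (s : rect b) :
    ofBlocks b B (scale b w + s) = B w s := by
  rw [ofBlocks, blockIndex_scale_add, offset_scale_add]

theorem pattern_ofBlocks {A : Type} (B : Pos d → rect b → A) (w : Pos d) :
    pattern (ofBlocks b B) (scale b w) (rect b) = B w :=
  funext fun s => ofBlocks_scale_add b B w s

end Blocks

namespace BlockEncoding

variable {d : ℕ} {T₁ T₂ : Turedo d} (E : BlockEncoding T₁ T₂)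

theorem mem_cell {z x : Pos d} :
    x ∈ E.cell z ↔ ∀ i, (E.b i : ℕ) * z i ≤ x i ∧ x i < (E.b i : ℕ) * z i + (E.b i : ℕ) := by
  constructor
  · rintro ⟨y, hy, rfl⟩ i
    have := hy i
    simp only [scale, Pi.add_apply]
    omega
  · intro h
    refine ⟨x - scale E.b z, fun i => ?_, by simp⟩
    have := h i
    simp only [scale, Pi.sub_apply]
    omega

theorem Decodes.pos {E : BlockEncoding T₁ T₂} {g₂ : T₂.State} {g₁ : T₁.State}
    (h : E.Decodes g₂ g₁) :
    blockIndex E.b g₂.pos = g₁.pos := by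
  obtain ⟨h, rfl⟩ := h
  rfl

theorem Decodes.α_pattern {E : BlockEncoding T₁ T₂} {g₂ : T₂.State} {g₁ : T₁.State}
    (h : E.Decodes g₂ g₁) {z : Pos d}
    (hz : z ≠ g₁.pos) :
    E.α (pattern g₂.conf (scale E.b z) (rect E.b)) = some (g₁.conf z) := by
  obtain ⟨h, rfl⟩ := h
  have hz : z ≠ blockIndex E.b g₂.pos := hz
  simp only [decode, dif_neg hz]
  exact (Option.some_get _).symm

/-- A choice of blocks for the letters of `T₁`, the blank block being chosen for the blank. -/
structure Section where
  block : T₁.A → rect E.b → T₂.A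
  α_block : ∀ a, E.α (block a) = some a
  block_blank : block T₁.blank = fun _ => T₂.blank

theorem nonempty_section : Nonempty E.Section := by
  classical
  choose u hu using E.α_onto
  refine ⟨⟨Function.update u T₁.blank fun _ => T₂.blank, fun a => ?_, by simp⟩⟩
  by_cases ha : a = T₁.blank
  · subst ha
    simpa using E.α_blank
  · simpa [ha] using hu a

open Classical in
/-- Changing the block chosen for a nonblank letter. -/
noncomputable def Section.set {E : BlockEncoding T₁ T₂} (u : E.Section) (a : T₁.A)
    (ha : a ≠ T₁.blank) (B : rect E.b → T₂.A) (hB : E.α B = some a) : E.Section where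
  block := Function.update u.block a B
  α_block a' := by
    by_cases h : a' = a
    · subst h
      simpa using hB
    · simpa [h] using u.α_block a'
  block_blank := by simpa [ha.symm] using u.block_blank

open Classical in
/-- The global state with head block `v` at index `w` and the other blocks given by a section. -/
noncomputable def Section.encode {E : BlockEncoding T₁ T₂} (u : E.Section)
    (v : (rect E.b → T₂.A) × rect E.b × T₂.Q) (c : Pos d → T₁.A) (w : Pos d) : T₂.State where
  conf := ofBlocks E.b fun z => if z = w then v.1 else u.block (c z)
  pos := scale E.b w + v.2.1
  state := v.2.2

/-- The domains match because the blank gets the blank block, while a nonblank letter cannot have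
it: `α` decodes that block to the blank. -/
theorem Section.represents_encode {E : BlockEncoding T₁ T₂} (u : E.Section)
    {v : (rect E.b → T₂.A) × rect E.b × T₂.Q} {c : Pos d → T₁.A} {w : Pos d} {q : T₁.Q}
    (hv : E.β v = some (q, c w)) (hc : {z | c z ≠ T₁.blank}.Finite) :
    E.Represents (u.encode v c w) ⟨c, w, q⟩ := by
  have hidx : blockIndex E.b (u.encode v c w).pos = w := blockIndex_scale_add _ _ _
  have href : refPoint E.b (u.encode v c w).pos = scale E.b w := by rw [refPoint, hidx]
  have hhead : E.headBlock (u.encode v c w) = v := by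
    rw [headBlock, href]
    simp [encode, pattern_ofBlocks, offset_scale_add]
  have hother : ∀ z ≠ w,
      pattern (u.encode v c w).conf (scale E.b z) (rect E.b) = u.block (c z) := by
    intro z hz
    simp [encode, pattern_ofBlocks, hz]
  have hvalid : E.Valid (u.encode v c w) := by
    refine ⟨by simp [hhead, hv], fun z' hz' => ?_⟩
    have hne : blockIndex E.b z' ≠ w := by
      rintro rfl
      exact hz' href.symm
    rw [refPoint, hother _ hne, u.α_block]
    rfl
  refine ⟨(Set.finite_singleton w).union hc, ?_, hvalid, ?_⟩
  · ext z
    simp only [Turedo.domain, blockDomain, href, Set.mem_ofPred_eq, Set.mem_union,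
      Set.mem_singleton_iff, (scale_injective E.b).eq_iff]
    by_cases hz : z = w
    · simp [hz]
    · simp only [hz, false_or, hother z hz, not_iff_not]
      refine ⟨fun h => by rw [h, u.block_blank], fun h => ?_⟩
      have := u.α_block (c z)
      rw [h, E.α_blank] at this
      exact (Option.some.inj this).symm
  · ext z
    · simp only [decode]
      split_ifs with h
      · rw [hidx] at h
        simp [hhead, hv, h]
      · rw [hidx] at h
        simp [hother z h, u.α_block]
    · exact congrFun hidx z
    · simp [decode, hhead, hv]

theorem mem_cell_blockIndex (z : Pos d) : z ∈ E.cell (blockIndex E.b z) :=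
  ⟨offset E.b z, (offset E.b z).2, (refPoint_add_offset E.b z).symm⟩

theorem Section.set_block_self {E : BlockEncoding T₁ T₂} (u : E.Section) {a : T₁.A}
    (ha : a ≠ T₁.blank) {B : rect E.b → T₂.A} (hB : E.α B = some a) :
    (u.set a ha B hB).block a = B := by
  simp [set]

theorem Section.agreeOn_encode {E : BlockEncoding T₁ T₂} (u u' : E.Section)
    (v : (rect E.b → T₂.A) × rect E.b × T₂.Q) (c c' : Pos d → T₁.A) (w : Pos d) {S : Set (Pos d)}
    (h : ∀ z ∈ S, u.block (c (blockIndex E.b z)) (offset E.b z) =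
      u'.block (c' (blockIndex E.b z)) (offset E.b z)) :
    T₂.AgreeOn S (u.encode v c w) (u'.encode v c' w) := by
  refine ⟨rfl, rfl, fun z hz => ?_⟩
  simp only [encode, ofBlocks]
  split_ifs
  · rfl
  · exact h z hz

end BlockEncoding

theorem BlockEncoding.mem_cell_two {T₁ T₂ : Turedo 2} (E : BlockEncoding T₁ T₂) {z x : Pos 2} :
    x ∈ E.cell z ↔ ((E.b 0 : ℕ) * z 0 ≤ x 0 ∧ x 0 < (E.b 0 : ℕ) * z 0 + (E.b 0 : ℕ)) ∧
      (E.b 1 : ℕ) * z 1 ≤ x 1 ∧ x 1 < (E.b 1 : ℕ) * z 1 + (E.b 1 : ℕ) := by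
  rw [E.mem_cell, Fin.forall_fin_two]

/-! The turedo that is not simulated. -/

theorem right_mem_ball : ![1, 0] ∈ ball 2 1 := by simp [mem_ball_two]

theorem up_mem_ball : ![0, 1] ∈ ball 2 1 := by simp [mem_ball_two]

/-- A nonblank letter, equal to the given letter if that one is not blank. -/
def fill {A : Type} (a : Option (Option A)) : {a : Option (Option A) // a ≠ none} :=
  ⟨some (a.getD none), by simp⟩

/-- From state `0` the turedo goes right twice, copies its right neighbour and goes up; from
state `4` it copies its upper neighbour and goes right. -/
abbrev probe (A : Type) [Finite A] : Turedo 2 where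
  radius := 1
  A := Option (Option A)
  Q := Fin 5
  blank := none
  finite_A := inferInstance
  finite_Q := inferInstance
  δ x := match x.1 with
    | 0 => (1, fill none, ⟨_, right_mem_ball⟩)
    | 1 => (2, fill none, ⟨_, right_mem_ball⟩)
    | 2 => (3, fill (x.2 ⟨_, right_mem_ball⟩), ⟨_, up_mem_ball⟩)
    | 3 => (3, fill none, ⟨_, up_mem_ball⟩)
    | 4 => (4, fill (x.2 ⟨_, up_mem_ball⟩), ⟨_, right_mem_ball⟩)

/-- The configuration with a single nonblank letter. -/
def singleConf {A : Type} (w : Pos 2) (y : Option A) : Pos 2 → Option (Option A) :=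
  Function.update (fun _ => none) w (some y)

theorem finite_singleConf {A : Type} (w : Pos 2) (y : Option A) :
    {z | singleConf w y z ≠ none}.Finite := by
  refine (Set.finite_singleton w).subset fun z hz => ?_
  by_contra h
  exact hz (Function.update_of_ne h _ _)

theorem singleConf_of_ne {A : Type} {w z : Pos 2} (y : Option A) (h : z ≠ w) :
    singleConf w y z = none :=
  Function.update_of_ne h _ _

theorem probe_step_zero {A : Type} [Finite A] {c : Pos 2 → Option (Option A)} {p : Pos 2}
    (h : c p = none) (h' : c (p + ![1, 0]) = none) :
    (probe A).step ⟨c, p, (0 : Fin 5)⟩ =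
      ⟨Function.update c p (some none), p + ![1, 0], (1 : Fin 5)⟩ :=
  (probe A).step_of_blank (g := ⟨c, p, (0 : Fin 5)⟩) h h'

theorem probe_step_one {A : Type} [Finite A] {c : Pos 2 → Option (Option A)} {p : Pos 2}
    (h : c p = none) (h' : c (p + ![1, 0]) = none) :
    (probe A).step ⟨c, p, (1 : Fin 5)⟩ =
      ⟨Function.update c p (some none), p + ![1, 0], (2 : Fin 5)⟩ :=
  (probe A).step_of_blank (g := ⟨c, p, (1 : Fin 5)⟩) h h'

theorem probe_step_two {A : Type} [Finite A] {c : Pos 2 → Option (Option A)} {p : Pos 2}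
    {y : Option A} (hy : c (p + ![1, 0]) = some y)
    (h : c p = none) (h' : c (p + ![0, 1]) = none) :
    (probe A).step ⟨c, p, (2 : Fin 5)⟩ =
      ⟨Function.update c p (some y), p + ![0, 1], (3 : Fin 5)⟩ := by
  have := (probe A).step_of_blank (g := ⟨c, p, (2 : Fin 5)⟩) h h'
  rw [this]
  change GlobalState.mk (Function.update c p (fill (c (p + ![1, 0]))).1) _ _ = _
  rw [hy]
  rfl

theorem probe_step_three {A : Type} [Finite A] {c : Pos 2 → Option (Option A)} {p : Pos 2}
    (h : c p = none) (h' : c (p + ![0, 1]) = none) :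
    (probe A).step ⟨c, p, (3 : Fin 5)⟩ =
      ⟨Function.update c p (some none), p + ![0, 1], (3 : Fin 5)⟩ :=
  (probe A).step_of_blank (g := ⟨c, p, (3 : Fin 5)⟩) h h'

theorem probe_step_four {A : Type} [Finite A] {c : Pos 2 → Option (Option A)} {p : Pos 2}
    {y : Option A} (hy : c (p + ![0, 1]) = some y)
    (h : c p = none) (h' : c (p + ![1, 0]) = none) :
    (probe A).step ⟨c, p, (4 : Fin 5)⟩ =
      ⟨Function.update c p (some y), p + ![1, 0], (4 : Fin 5)⟩ := by
  have := (probe A).step_of_blank (g := ⟨c, p, (4 : Fin 5)⟩) h h'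
  rw [this]
  change GlobalState.mk (Function.update c p (fill (c (p + ![0, 1]))).1) _ _ = _
  rw [hy]
  rfl

/-- The start of the walk that copies the letter `y` at `(2, 0)` to `(1, 0)`. -/
def copyStart {A : Type} [Finite A] (y : Option A) : (probe A).State :=
  ⟨singleConf ![2, 0] y, ![-1, 0], (0 : Fin 5)⟩

theorem orbit_copyStart {A : Type} [Finite A] (y : Option A) :
    ((probe A).orbit 1 (copyStart y)).pos = ![0, 0] ∧
    ((probe A).orbit 2 (copyStart y)).pos = ![1, 0] ∧
    ((probe A).orbit 3 (copyStart y)).pos = ![1, 1] ∧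
    ((probe A).orbit 4 (copyStart y)).pos = ![1, 2] ∧
    ((probe A).orbit 4 (copyStart y)).conf ![1, 0] = some y := by
  have h1 : (probe A).orbit 1 (copyStart y) = _ :=
    probe_step_zero (by simp [singleConf]) (by simp [singleConf])
  have h2 := ((probe A).orbit_succ 1 (copyStart y)).trans ((congrArg _ h1).trans
    (probe_step_one (by simp [singleConf])
      (by simp [singleConf])))
  have h3 := ((probe A).orbit_succ 2 (copyStart y)).trans ((congrArg _ h2).trans
    (probe_step_two (y := y) (by simp [singleConf])
      (by simp [singleConf])
      (by simp [singleConf])))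
  have h4 := ((probe A).orbit_succ 3 (copyStart y)).trans ((congrArg _ h3).trans
    (probe_step_three (by simp [singleConf])
      (by simp [singleConf])))
  rw [h1, h2, h3, h4]
  simp

/-- The start of a step that copies the letter `y` at `(0, 1)` to the origin. -/
def readStart {A : Type} [Finite A] (y : Option A) : (probe A).State :=
  ⟨singleConf ![0, 1] y, ![0, 0], (4 : Fin 5)⟩

theorem orbit_readStart {A : Type} [Finite A] (y : Option A) :
    ((probe A).orbit 1 (readStart y)).pos = ![1, 0] ∧
    ((probe A).orbit 1 (readStart y)).conf ![0, 0] = some y := by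
  have h1 : (probe A).orbit 1 (readStart y) = _ :=
    probe_step_four (y := y) (by simp [singleConf]) (by simp [singleConf]) (by simp [singleConf])
  rw [h1]
  simp

/-! ### What a rigorous simulation of the copying walk can see and write. -/

namespace BlockEncoding

variable {T : Turedo 2}

section

variable {A : Type} [Finite A] {E : BlockEncoding (probe A) T} {k : ℕ}

/-- Where the head can be while `T` simulates the walk from `copyStart y`. -/
theorem IsRigorous.pos_copyStart (hrig : E.IsRigorous k) {y : Option A} {g : T.State}
    (hg : E.Represents g (copyStart y)) (t : ℕ) :
    (t ≤ k → -(E.b 0 : ℤ) ≤ (T.orbit t g).pos 0 ∧ (T.orbit t g).pos 0 < (E.b 0 : ℕ) ∧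
      0 ≤ (T.orbit t g).pos 1 ∧ (T.orbit t g).pos 1 < (E.b 1 : ℕ)) ∧
    (k ≤ t → t ≤ 2 * k → 0 ≤ (T.orbit t g).pos 0 ∧ (T.orbit t g).pos 0 < 2 * (E.b 0 : ℕ) ∧
      0 ≤ (T.orbit t g).pos 1 ∧ (T.orbit t g).pos 1 < (E.b 1 : ℕ)) ∧
    (2 * k ≤ t → t ≤ 3 * k →
      (E.b 0 : ℕ) ≤ (T.orbit t g).pos 0 ∧ (T.orbit t g).pos 0 < 2 * (E.b 0 : ℕ) ∧
      0 ≤ (T.orbit t g).pos 1 ∧ (T.orbit t g).pos 1 < 2 * (E.b 1 : ℕ)) ∧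
    (3 * k ≤ t → t ≤ 4 * k →
      (E.b 0 : ℕ) ≤ (T.orbit t g).pos 0 ∧ (T.orbit t g).pos 0 < 2 * (E.b 0 : ℕ) ∧
      (E.b 1 : ℕ) ≤ (T.orbit t g).pos 1 ∧ (T.orbit t g).pos 1 < 3 * (E.b 1 : ℕ)) := by
  obtain ⟨h1, h2, h3, h4, -⟩ := orbit_copyStart y
  have h0 : ((probe A).orbit 0 (copyStart y)).pos = ![-1, 0] := rfl
  have r := hrig _ _ hg
  have r0 := r 0 t
  have r1 := r 1 t
  have r2 := r 2 t
  have r3 := r 3 t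
  simp only [zero_add, Nat.reduceAdd, h0, h1, h2, h3, h4, Set.mem_union, mem_cell_two,
    Matrix.cons_val_zero, Matrix.cons_val_one] at r0 r1 r2 r3
  refine ⟨fun a => ?_, fun a b => ?_, fun a b => ?_, fun a b => ?_⟩
  · have := r0 (by omega) (by omega)
    omega
  · have := r1 (by omega) (by omega)
    omega
  · have := r2 (by omega) (by omega)
    omega
  · have := r3 (by omega) (by omega)
    omega

theorem Decodes.mem_cell_pos {T₁ : Turedo 2} {E : BlockEncoding T₁ T} {g : T.State}
    {g₁ : T₁.State} (h : E.Decodes g g₁) : g.pos ∈ E.cell g₁.pos :=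
  h.pos ▸ E.mem_cell_blockIndex g.pos

/-- Once the head has touched the right column of the block at `(1, 0)`, it no longer visits the
bottom row of this block. -/
theorem IsRigorous.not_mem_bottom (hrig : E.IsRigorous k) (hsim : E.IsSimulation k)
    {y : Option A} {g : T.State} (hg : E.Represents g (copyStart y)) {t₁ t : ℕ} (ht : t₁ < t)
    (htk : t ≤ 4 * k) (h₁ : (T.orbit t₁ g).pos 0 = 2 * (E.b 0 : ℕ) - 1) :
    (T.orbit t g).pos 1 ≠ 0 := by
  intro h
  have hP := hrig.pos_copyStart hg
  have hstart : (T.orbit 0 g).pos 0 < 0 := by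
    have := (hsim _ _ hg 0).mem_cell_pos
    rw [mem_cell_two] at this
    have h0 : ((probe A).orbit 0 (copyStart y)).pos = ![-1, 0] := rfl
    simp only [h0, Matrix.cons_val_zero, mul_zero] at this
    omega
  have hend : 2 * (E.b 1 : ℕ) ≤ (T.orbit (4 * k) g).pos 1 := by
    have := (hsim _ _ hg 4).mem_cell_pos
    rw [mem_cell_two, (orbit_copyStart y).2.2.2.1, mul_comm k] at this
    simp only [Matrix.cons_val_zero, Matrix.cons_val_one] at this
    omega
  have hkt : k < t₁ := by
    by_contra hlt
    have := (hP t₁).1 (by omega)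
    omega
  have htk3 : t ≤ 3 * k := by
    by_contra hlt
    have := (hP t).2.2.2 (by omega) (by omega)
    omega
  -- The path up to `t₁` joins a negative column to column `2 * b 0 - 1` below row `2 * b 1`. The
  -- path from `t` on climbs from row 0 to at least row `2 * b 1` between these columns; it stays in
  -- nonnegative columns because `k < t`.
  obtain ⟨i, hi, j, hj, hij⟩ := exists_eq_of_crossing (p := fun i => (T.orbit i g).pos)
    (q := fun j => (T.orbit (t + j) g).pos) (m := t₁) (n := 4 * k - t) (H := 2 * (E.b 1 : ℕ))
    (fun i _ => abs_orbit_pos_sub_le g i) (fun j _ => abs_orbit_pos_sub_le g (t + j))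
    (fun i hi => by have := hP i; omega)
    (fun j hj => by have := hP (t + j); omega)
    (fun j hj => by have := hP (t + j); omega) h.le
    (by simpa only [Nat.add_sub_cancel' htk] using hend)
  -- The meeting point was visited at time `i ≤ t₁ < t + j`, so the head is stuck there, below row
  -- `2 * b 1`, and cannot finish the walk.
  have := T.orbit_pos_eq_of_revisit (n := 4 * k) (by omega) (by omega) hij
  rw [this, ← hij] at hend
  have := hP i
  omega

end

/-- There are blocks of different letters with the same bottom row. -/
theorem exists_blocks_same_bottom (hr : T.radius = 1) [Finite T.A]
    {E : BlockEncoding (probe T.A) T} {k : ℕ}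
    (hsim : E.IsSimulation k) (hrig : E.IsRigorous k) :
    ∃ y y' : Option T.A, y ≠ y' ∧ ∃ B B' : rect E.b → T.A, E.α B = some (some y) ∧
      E.α B' = some (some y') ∧ ∀ s : rect E.b, s.1 1 = 0 → B s = B' s := by
  obtain ⟨u⟩ := E.nonempty_section
  obtain ⟨v, hv⟩ := E.β_onto ((0 : Fin 5), none)
  let g (y : Option T.A) : T.State := u.encode v (singleConf ![2, 0] y) ![-1, 0]
  have hg (y) : E.Represents (g y) (copyStart y) := by
    refine u.represents_encode ?_ (finite_singleConf _ _)
    rw [hv, singleConf_of_ne _ (by simp)]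
  have hP (y) := hrig.pos_copyStart (hg y)
  have hα (y) : E.α (pattern (T.orbit (4 * k) (g y)).conf (scale E.b ![1, 0]) (rect E.b)) =
      some (some y) := by
    have h := (hsim _ _ (hg y) 4).α_pattern (z := ![1, 0])
      (by rw [(orbit_copyStart y).2.2.2.1]; simp)
    rwa [(orbit_copyStart y).2.2.2.2, mul_comm k] at h
  -- Only the block at (2,0) depends on the letter.
  let S : Set (Pos 2) := {z | z ∉ E.cell ![2, 0]}
  have mem_S {z : Pos 2} (h : z 0 < 2 * (E.b 0 : ℕ) ∨ (E.b 1 : ℕ) ≤ z 1 ∨ z 1 < 0) : z ∈ S := by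
    intro hz
    rw [mem_cell_two] at hz
    simp only [Matrix.cons_val_zero, Matrix.cons_val_one] at hz
    omega
  have hS (y y') : T.AgreeOn S (g y) (g y') := by
    refine u.agreeOn_encode u _ _ _ _ fun z hz => ?_
    have hne : blockIndex E.b z ≠ ![2, 0] := fun h => hz (h ▸ E.mem_cell_blockIndex z)
    rw [singleConf_of_ne _ hne, singleConf_of_ne _ hne]
  have hball {y : Option T.A} {t : ℕ} (ht : t < 4 * k)
      (hC : ¬ ((T.orbit t (g y)).pos 0 = 2 * (E.b 0 : ℕ) - 1 ∧
        (T.orbit t (g y)).pos 1 < (E.b 1 : ℕ))) :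
      ∀ s ∈ ball 2 1, (T.orbit t (g y)).pos + s ∈ S := by
    intro s hs
    have hs := eq_of_abs_add_abs_le_one (a := 0) (b := 0) (by simpa using mem_ball_two.1 hs)
    have := hP y t
    apply mem_S
    simp only [Pi.add_apply]
    omega
  suffices h : ∃ y y', y ≠ y' ∧ ∀ z : Pos 2, z 1 = 0 → z 0 < 2 * (E.b 0 : ℕ) →
      (T.orbit (4 * k) (g y)).conf z = (T.orbit (4 * k) (g y')).conf z by
    obtain ⟨y, y', hne, h⟩ := h
    refine ⟨y, y', hne, _, _, hα y, hα y', fun s hs => h _ ?_ ?_⟩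
    · simp [scale, hs]
    · have := (s.2 0).2
      simp only [scale, Pi.add_apply, Matrix.cons_val_zero]
      omega
  by_cases hex : ∃ t, t < 4 * k ∧ (T.orbit t (g none)).pos 0 = 2 * (E.b 0 : ℕ) - 1 ∧
      (T.orbit t (g none)).pos 1 < (E.b 1 : ℕ)
  · classical
    obtain ⟨t₁, ⟨ht₁, hC⟩, hmin⟩ : ∃ t₁, (t₁ < 4 * k ∧
        (T.orbit t₁ (g none)).pos 0 = 2 * (E.b 0 : ℕ) - 1 ∧
        (T.orbit t₁ (g none)).pos 1 < (E.b 1 : ℕ)) ∧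
        ∀ t < t₁, ¬ (t < 4 * k ∧ (T.orbit t (g none)).pos 0 = 2 * (E.b 0 : ℕ) - 1 ∧
          (T.orbit t (g none)).pos 1 < (E.b 1 : ℕ)) :=
      ⟨Nat.find hex, Nat.find_spec hex, fun t ht => Nat.find_min hex ht⟩
    have hagree (y) : T.AgreeOn S (T.orbit t₁ (g none)) (T.orbit t₁ (g y)) :=
      (hS none y).orbit hr fun i hi => hball (hi.trans ht₁) fun h => hmin i hi ⟨hi.trans ht₁, h⟩
    have := Fintype.ofFinite T.A
    -- There is one letter more than there are symbols that the single visible cell can carry.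
    obtain ⟨y, y', hne, hy⟩ := Fintype.exists_ne_map_eq_of_card_lt
      (fun y : Option T.A => (T.orbit t₁ (g y)).conf ((T.orbit t₁ (g none)).pos + ![1, 0]))
      (by simp)
    have hsucc : T.AgreeOn (insert ((T.orbit t₁ (g none)).pos + ![1, 0]) S)
        (T.orbit (t₁ + 1) (g y)) (T.orbit (t₁ + 1) (g y')) := by
      rw [T.orbit_succ, T.orbit_succ]
      obtain ⟨e1, e2, e3⟩ := (hagree y).symm.trans (hagree y')
      refine Turedo.AgreeOn.step hr ⟨e1, e2, ?_⟩ fun s hs => ?_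
      · rintro z (rfl | hz)
        · exact hy
        · exact e3 z hz
      · rw [← (hagree y).1]
        by_cases hsr : s = ![1, 0]
        · exact Or.inl (by rw [hsr])
        · have hs := eq_of_abs_add_abs_le_one (a := 0) (b := 0) (by simpa using mem_ball_two.1 hs)
          have hsr : ¬ (s 0 = 1 ∧ s 1 = 0) := fun h =>
            hsr (funext fun i => by fin_cases i <;> simp [h.1, h.2])
          refine Or.inr (mem_S ?_)
          simp only [Pi.add_apply]
          omega
    -- Row 0 is final after the contact step: that step may still write in it, but later the head
    -- never visits it.
    have hkeep (y) {z : Pos 2} (hz : z 1 = 0) :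
        (T.orbit (4 * k) (g y)).conf z = (T.orbit (t₁ + 1) (g y)).conf z := by
      refine T.orbit_conf_eq ht₁ fun l hl hl' h => ?_
      refine hrig.not_mem_bottom hsim (hg y) hl hl'.le ?_ (h ▸ hz)
      rw [← (hagree y).1, hC.1]
    refine ⟨y, y', hne, fun z hz hz' => ?_⟩
    rw [hkeep y hz, hkeep y' hz]
    exact hsucc.2.2 z (Or.inr (mem_S (Or.inl hz')))
  -- Without contact the block at (2,0) is never seen, so any two letters do.
  · refine ⟨none, some T.blank, by simp, fun z _ hz => ?_⟩
    refine ((hS _ _).orbit hr fun i hi => hball hi fun h => hex ⟨i, hi, h⟩).2.2 z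
      (mem_S (Or.inl hz))

end BlockEncoding

/-- A simulation has to be correct for every block that decodes to a given letter, so the two blocks
with a common bottom row may be placed above the head. -/
theorem not_rigSim_probe {T : Turedo 2} (hr : T.radius = 1) [Finite T.A] :
    ¬ RigSim (probe T.A) T := by
  rintro ⟨E, k, -, hsim, hrig⟩
  obtain ⟨y, y', hne, B, B', hB, hB', hbot⟩ := E.exists_blocks_same_bottom hr hsim hrig
  obtain ⟨u⟩ := E.nonempty_section
  obtain ⟨v, hv⟩ := E.β_onto ((4 : Fin 5), none)
  have hsome (y : Option T.A) : some y ≠ (probe T.A).blank := Option.some_ne_none y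
  let g (y : Option T.A) (B : rect E.b → T.A) (hB : E.α B = some (some y)) : T.State :=
    (u.set (some y) (hsome y) B hB).encode v (singleConf ![0, 1] y) ![0, 0]
  have hg (y B hB) : E.Represents (g y B hB) (readStart y) := by
    refine BlockEncoding.Section.represents_encode _ ?_ (finite_singleConf _ _)
    rw [hv, singleConf_of_ne _ (by simp)]
  have hα (y B hB) : E.α (pattern (T.orbit k (g y B hB)).conf (scale E.b ![0, 0]) (rect E.b)) =
      some (some y) := by
    have h := (hsim _ _ (hg y B hB) 1).α_pattern (z := ![0, 0])
      (by rw [(orbit_readStart y).1]; simp)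
    rwa [(orbit_readStart y).2, mul_one] at h
  let S : Set (Pos 2) := {z | z ∈ E.cell ![0, 1] → z 1 = (E.b 1 : ℕ)}
  have hS : T.AgreeOn S (g y B hB) (g y' B' hB') := by
    refine BlockEncoding.Section.agreeOn_encode _ _ _ _ _ _ fun z hz => ?_
    by_cases h : blockIndex E.b z = ![0, 1]
    · have h1 := hz (h ▸ E.mem_cell_blockIndex z)
      have e (y : Option T.A) : singleConf ![0, 1] y (blockIndex E.b z) = some y := by
        simp [h, singleConf]
      rw [e, e, u.set_block_self, u.set_block_self]
      exact hbot (offset E.b z) (by simp [offset, h1])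
    · rw [singleConf_of_ne _ h, singleConf_of_ne _ h]
      exact ((u.set _ (hsome y) B hB).block_blank ▸ (u.set _ (hsome y') B' hB').block_blank ▸ rfl)
  -- During this simulated step the head stays in the blocks (0,0) and (1,0), below row `b 1`, so
  -- its unit ball reaches at most the bottom row of the block (0,1).
  have hk := hS.orbit hr (t := k) fun i hi s hs hmem => by
    have hs := eq_of_abs_add_abs_le_one (a := 0) (b := 0) (by simpa using mem_ball_two.1 hs)
    have h0 : ((probe T.A).orbit 0 (readStart y)).pos = ![0, 0] := rfl
    have hpos := hrig _ _ (hg y B hB) 0 i (by omega) (by omega)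
    rw [zero_add, h0, (orbit_readStart y).1, Set.mem_union, E.mem_cell_two,
      E.mem_cell_two] at hpos
    rw [E.mem_cell_two] at hmem
    simp only [Matrix.cons_val_zero, Matrix.cons_val_one, Pi.add_apply] at hpos hmem ⊢
    omega
  have heq : pattern (T.orbit k (g y B hB)).conf (scale E.b ![0, 0]) (rect E.b) =
      pattern (T.orbit k (g y' B' hB')).conf (scale E.b ![0, 0]) (rect E.b) := by
    funext s
    refine hk.2.2 _ fun hmem => ?_
    have h1 := (s.2 1).2
    rw [E.mem_cell_two] at hmem
    simp only [scale, Pi.add_apply, Matrix.cons_val_zero, Matrix.cons_val_one] at hmem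
    omega
  have := hα y B hB
  rw [heq, hα y' B' hB'] at this
  exact hne (Option.some.inj (Option.some.inj this)).symm

end TuredoModel

theorem mainTheorem4 :
    (∀ T ∈ TuredoModel.TUR 2 1, ∃ T' ∈ TuredoModel.TUR 2 1, ¬ TuredoModel.RigSim T' T) ∧
      TuredoModel.rigUniv 2 1 ∩ TuredoModel.TUR 2 1 = ∅ := by
  have h : ∀ T ∈ TuredoModel.TUR 2 1,
      ∃ T' ∈ TuredoModel.TUR 2 1, ¬ TuredoModel.RigSim T' T := fun T hT =>
    have := T.finite_A
    ⟨TuredoModel.probe T.A, rfl, TuredoModel.not_rigSim_probe hT⟩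
  refine ⟨h, Set.eq_empty_of_forall_notMem fun T hT => ?_⟩
  obtain ⟨T', hT', hn⟩ := h T hT.2
  exact hn (hT.1.2 T' hT')
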